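/- **Setting.** Let $\mathcal A,\mathcal Y$ be finite non-empty sets of actions and states, $\mathcal P$ a set of policies, $\mathcal P_0\subseteq\mathcal P$ a finite non-empty set of benchmark policies, and $U,V:\mathcal A\times\mathcal P\times\mathcal Y\to[-1,1]$ the utilities of the Agent and of the Principal; $U(a,p,\pi),V(a,p,\pi)$ are their expectations over $y\sim\pi\in\Delta(\mathcal Y)$. Let $a^*(p,\pi)$ maximize $V(\cdot,p,\pi)$ over $\operatorname{argmax}_a U(a,p,\pi)$, and let $p^*(\pi)\in\operatorname{argmax}_{p\in\mathcal P_0}V(a^*(p,\pi),p,\pi)$, with ties broken arbitrarily. There are $T\ge1$ rounds and a sequence of states $y_{1:T}$. A forecasting algorithm $\mathcal F$ draws $\pi_t\in\Delta(\mathcal Y)$ from a discrete distribution that depends on $y_{1:t-1},\pi_{1:t-1}$. A choice rule $\psi$ (here $p^*$, or a constant $p_0\in\mathcal P_0$) gives the policy $p_t=\psi(\pi_t)$ and the recommendation $r_t=a^*(p_t,\pi_t)$, and the Agent draws $a_t\sim\mathcal L_t(y_{1:t-1},a_{1:t-1},r_{1:t},p_{1:t})$. Write $p_t,r_t,a_t$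 for the play under $\psi=p^*$ and $p_0,r_t^{p_0},a_t^{p_0}$ for the play under the constant rule $p_0$ (with the same forecasts). The policy regret of $\sigma^\dagger=(\mathcal F,p^*)$ is $$\mathrm{PR}(\sigma^\dagger,\mathcal L,y_{1:T})=\mathbb E_{\pi_{1:T}}\Big[\max_{p_0\in\mathcal P_0}\mathbb E_{a_{1:T},a^{p_0}_{1:T}}\Big[\tfrac1T\sum_{t=1}^T\big(V(a_t^{p_0},p_0,y_t)-V(a_t,p_t,y_t)\big)\Big]\Big].$$ **Forecasts.** Let $\mathcal E'=\mathcal E_3\cup\mathcal E_4$, where $\mathcal E_3$ consists of the events $\{a^*(p_0,\pi)=a\}$ and $\mathcal E_4$ of the events $\{p^*(\pi)=p,\ a^*(p,\pi)=a\}$, for $p_0,p\in\mathcal P_0$ and $a\in\mathcal A$ (so $|\mathcal E'|=2|\mathcal P_0||\mathcal A|$, counted as an indexed family). With states identified with their one-hot vectors, $\ell=\ln(|\mathcal Y||\mathcal E'|T)$ and $n_E=|\{t:\pi_t\in E\}|$, call $\mathcal F$ *$K$-unbiased on $\mathcal E'$* if for every sequence $y_{1:T}$ $$\mathbb E_{\pi_{1:T}}\Bigg[\max_{E\in\mathcal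 E'}\ \frac{\frac1T\big\|\sum_{t}\mathbf 1[\pi_t\in E](\pi_t-y_t)\big\|_1}{\frac{|\mathcal Y|\ell}{T}+\frac{|\mathcal Y|\sqrt{\ell\, n_E}}{T}}\Bigg]\le K .$$ This is the guarantee for which the forecasting algorithm of Noarov, Ramalingam, Roth and Xie (NRRX23) is used. **Assumptions**, for given $y_{1:T}$, $\mathcal L$, and every forecast sequence $\pi_{1:T}$ that $\mathcal F$ produces with positive probability against $y_{1:T}$. Each is required for $(p_{1:T},r_{1:T},a_{1:T})$ and, for every $p_0\in\mathcal P_0$, for $((p_0,\dots,p_0),r^{p_0}_{1:T},a^{p_0}_{1:T})$; $h,h'$ are $\mathcal A$-valued functions. 1. *No contextual swap regret*: $\mathbb E_{a_{1:T}}\big[\max_h\frac1T\sum_t\big(U(h(p_t,r_t,a_t),p_t,y_t)-U(a_t,p_t,y_t)\big)\big]\le\epsilon_{\rm swap}$. 2. *Alignment* with $M_1\ge0$ and $M_2\in\mathbb R$: for every action sequence of positive probability, with $\mathrm{UGap}=\frac1T\max_h\min_{h'}\sum_t\big(U(h(p_t,r_t,a_t),p_t,y_t)-U(h'(p_t,r_t),p_t,y_t)\big)$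 evaluated on the respective play, $\frac1T\sum_t\big(V(r_t,p_t,y_t)-V(a_t,p_t,y_t)\big)\le M_1\mathrm{UGap}+M_2$ under the rule $p^*$, and $\frac1T\sum_t\big(V(a^{p_0}_t,p_0,y_t)-V(r^{p_0}_t,p_0,y_t)\big)\le M_1\mathrm{UGap}+M_2$ under the constant rule $p_0$. 3. *No negative cross-swap-regret*: $\frac1T\mathbb E_{a_{1:T}}\big[\sum_tU(a_t,p_t,y_t)-\max_h\sum_tU(h(p_t,r_t),p_t,y_t)\big]\le\epsilon_{\rm neg}$. **Theorem.** There is an absolute constant $K_0>0$ such that for every $K\ge K_0$ there is a constant $C>0$, depending only on $K$, with the following property. For every game as above, every choice of $a^*$ and $p^*$, and every $T\ge1$, there is a forecasting algorithm that is $K$-unbiased on $\mathcal E'$; and for every such forecasting algorithm $\mathcal F$, every $\mathcal L$ and $y_{1:T}$, and all $\epsilon_{\rm swap},\epsilon_{\rm neg},M_2\in\mathbb R$ and $M_1\ge0$ for which Assumptions 1–3 hold, the mechanism $\sigma^\dagger=(\mathcal F,p^*)$ satisfies $$\mathrm{PR}(\sigma^\dagger,\mathcal L,y_{1:T})\le C\,|\mathcal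 Y|\sqrt{\frac{|\mathcal P_0||\mathcal A|}{T}}\,\sqrt{\ln\big(2|\mathcal Y||\mathcal P_0||\mathcal A|T\big)}+2\big(M_1(\epsilon_{\rm swap}+\epsilon_{\rm neg})+M_2\big).$$ -/

import Mathlib

namespace PrincipalAgent

/-- Expectation of a real function under a discrete distribution. It is only applied to bounded
functions, so the sum always converges. -/
noncomputable def expect {α : Type*} (μ : PMF α) (f : α → ℝ) : ℝ :=
  ∑' x, (μ x).toReal * f x

/-- The one-hot encoding of a state. -/
noncomputable def oneHot {Y : Type*} (y k : Y) : ℝ :=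
  open Classical in if y = k then 1 else 0

/-- A principal-agent stage game: Agent utility `U a p y`, Principal utility `V a p y`, both with
values in `[-1, 1]`, and a finite non-empty set `P₀` of benchmark policies. -/
structure Game (P A Y : Type*) where
  U : A → P → Y → ℝ
  V : A → P → Y → ℝ
  P₀ : Finset P
  P₀_nonempty : P₀.Nonempty
  U_mem : ∀ a p y, U a p y ∈ Set.Icc (-1 : ℝ) 1
  V_mem : ∀ a p y, V a p y ∈ Set.Icc (-1 : ℝ) 1

/-- An Agent learning algorithm. Its action distribution in (zero-based) round `t` depends on the
past states, the past actions, and the past and current recommendations and policies. -/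
abbrev AgentAlg (P A Y : Type*) :=
  (t : ℕ) → (Fin t → Y) → (Fin t → A) → (Fin (t + 1) → A) → (Fin (t + 1) → P) → PMF A

/-- Law of the Agent's action sequence for given states `y`, policies `p`, recommendations `r`. -/
noncomputable def actionLaw {P A Y : Type*} (L : AgentAlg P A Y) :
    (T : ℕ) → (Fin T → Y) → (Fin T → P) → (Fin T → A) → PMF (Fin T → A)
  | 0, _, _, _ => PMF.pure Fin.elim0
  | T + 1, y, p, r =>
      (actionLaw L T (fun i => y i.castSucc) (fun i => p i.castSucc)
          (fun i => r i.castSucc)).bind fun a =>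
        (L T (fun i => y i.castSucc) a r p).map fun b => Fin.snoc (α := fun _ => A) a b

/-- A max over `P₀` of a real function. -/
noncomputable def Game.maxBenchmark {P A Y : Type*} (G : Game P A Y) (f : P → ℝ) : ℝ :=
  G.P₀.sup' G.P₀_nonempty f

section Finite

variable {P A Y : Type*} [Fintype Y]

/-- A randomized forecasting algorithm: in round `t` it maps the past states and its own past
forecasts to a distribution over forecasts, a forecast being a point of the simplex over `Y`. -/
abbrev Forecaster (Y : Type*) [Fintype Y] :=
  (t : ℕ) → (Fin t → Y) → (Fin t → stdSimplex ℝ Y) → PMF (stdSimplex ℝ Y)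

/-- Law of the forecast sequence when the sequence of states is `y`. -/
noncomputable def forecastLaw (F : Forecaster Y) :
    (T : ℕ) → (Fin T → Y) → PMF (Fin T → stdSimplex ℝ Y)
  | 0, _ => PMF.pure Fin.elim0
  | T + 1, y =>
      (forecastLaw F T (fun i => y i.castSucc)).bind fun π =>
        (F T (fun i => y i.castSucc) π).map fun q =>
          Fin.snoc (α := fun _ => stdSimplex ℝ Y) π q

/-! Best responses to a prior. -/

/-- Agent's expected utility under the prior `π`. -/
noncomputable def Game.expU (G : Game P A Y) (a : A) (p : P) (π : stdSimplex ℝ Y) : ℝ :=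
  ∑ y, π.1 y * G.U a p y

/-- Principal's expected utility under the prior `π`. -/
noncomputable def Game.expV (G : Game P A Y) (a : A) (p : P) (π : stdSimplex ℝ Y) : ℝ :=
  ∑ y, π.1 y * G.V a p y

/-- The set of the Agent's best responses to policy `p` under the prior `π`. -/
def Game.bestResponses (G : Game P A Y) (p : P) (π : stdSimplex ℝ Y) : Set A :=
  {a | ∀ b, G.expU b p π ≤ G.expU a p π}

/-- `aStar` selects an Agent best response that is best for the Principal (remaining ties are
broken arbitrarily). -/
def Game.IsBestResponse (G : Game P A Y) (aStar : P → stdSimplex ℝ Y → A) : Prop :=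
  ∀ p π, aStar p π ∈ G.bestResponses p π ∧
    ∀ b ∈ G.bestResponses p π, G.expV b p π ≤ G.expV (aStar p π) p π

/-- `pStar` selects an optimal benchmark policy, given that the Agent responds with `aStar`
(ties are broken arbitrarily). -/
def Game.IsOptimalPolicy (G : Game P A Y) (aStar : P → stdSimplex ℝ Y → A)
    (pStar : stdSimplex ℝ Y → P) : Prop :=
  ∀ π, pStar π ∈ G.P₀ ∧
    ∀ p ∈ G.P₀, G.expV (aStar p π) p π ≤ G.expV (aStar (pStar π) π) (pStar π) π

/-! Conditional bias of forecasts. -/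

/-- The bias of the forecasts `π` on the event `E`: the `ℓ₁` norm of
`(1 / T) ∑ₜ 1[πₜ ∈ E] (πₜ - yₜ)`. -/
noncomputable def condBias {T : ℕ} (y : Fin T → Y) (π : Fin T → stdSimplex ℝ Y)
    (E : Set (stdSimplex ℝ Y)) : ℝ :=
  (1 / (T : ℝ)) * ∑ k : Y, |∑ t, E.indicator (fun q => q.1 k - oneHot (y t) k) (π t)|

/-- The number of rounds in which the event `E` occurs. -/
noncomputable def eventCount {T : ℕ} (π : Fin T → stdSimplex ℝ Y)
    (E : Set (stdSimplex ℝ Y)) : ℕ :=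
  {t | π t ∈ E}.ncard

/-- With `ℓ = log (|Y| m T)` for a collection of `m` events:
`|Y| ℓ / T + |Y| √(ℓ #{t | πₜ ∈ E}) / T`. -/
noncomputable def biasRate (m : ℕ) {T : ℕ} (π : Fin T → stdSimplex ℝ Y)
    (E : Set (stdSimplex ℝ Y)) : ℝ :=
  (Fintype.card Y : ℝ) * Real.log (Fintype.card Y * m * T) / T +
    (Fintype.card Y : ℝ) * √(Real.log (Fintype.card Y * m * T) * eventCount π E) / T

/-- The forecaster is unbiased conditional on the finite family `E` of events over the horizon
`T`: for every sequence of states, the largest ratio (over the events) of the conditional bias to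
`biasRate` is at most `K` in expectation. -/
def IsUnbiasedForecaster (K : ℝ) (F : Forecaster Y) (T : ℕ) {ι : Type*} [Fintype ι]
    (E : ι → Set (stdSimplex ℝ Y)) : Prop :=
  ∀ y : Fin T → Y,
    expect (forecastLaw F T y)
      (fun π => ⨆ i, condBias y π (E i) / biasRate (Fintype.card ι) π (E i)) ≤ K

/-- The events `aStar p₀ π = a`, for `p₀ ∈ P₀` and `a ∈ A`. -/
def Game.eventsConst (G : Game P A Y) (aStar : P → stdSimplex ℝ Y → A) :
    G.P₀ × A → Set (stdSimplex ℝ Y) :=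
  fun i => {π | aStar i.1 π = i.2}

/-- The events `pStar π = p ∧ aStar p π = a`, for `p ∈ P₀` and `a ∈ A`. -/
def Game.eventsMech (G : Game P A Y) (aStar : P → stdSimplex ℝ Y → A)
    (pStar : stdSimplex ℝ Y → P) : G.P₀ × A → Set (stdSimplex ℝ Y) :=
  fun i => {π | pStar π = i.1 ∧ aStar i.1 π = i.2}

/-- The union of the two collections of events. -/
def Game.events (G : Game P A Y) (aStar : P → stdSimplex ℝ Y → A)
    (pStar : stdSimplex ℝ Y → P) : (G.P₀ × A) ⊕ (G.P₀ × A) → Set (stdSimplex ℝ Y) :=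
  Sum.elim (G.eventsConst aStar) (G.eventsMech aStar pStar)

/-! Policies and recommendations generated from forecasts. -/

/-- Policies chosen by the rule `ψ`. The constant mechanism of `p₀` is `ψ = fun _ => p₀`. -/
def policies {T : ℕ} (ψ : stdSimplex ℝ Y → P) (π : Fin T → stdSimplex ℝ Y) : Fin T → P :=
  fun t => ψ (π t)

/-- The recommendations made together with the policies chosen by the rule `ψ`. -/
def recs {T : ℕ} (aStar : P → stdSimplex ℝ Y → A) (ψ : stdSimplex ℝ Y → P)
    (π : Fin T → stdSimplex ℝ Y) : Fin T → A :=
  fun t => aStar (ψ (π t)) (π t)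

/-- Law of the Agent's actions under the choice rule `ψ` and realized forecasts `π`. -/
noncomputable def playLaw {T : ℕ} (L : AgentAlg P A Y) (aStar : P → stdSimplex ℝ Y → A)
    (y : Fin T → Y) (π : Fin T → stdSimplex ℝ Y) (ψ : stdSimplex ℝ Y → P) : PMF (Fin T → A) :=
  actionLaw L T y (policies ψ π) (recs aStar ψ π)

/-! The Principal's policy regret. -/

/-- Policy regret for realized forecasts `π`, in expectation over the Agent's randomness. -/
noncomputable def Game.regretGiven (G : Game P A Y) (aStar : P → stdSimplex ℝ Y → A)
    (ψ : stdSimplex ℝ Y → P) (L : AgentAlg P A Y) {T : ℕ} (y : Fin T → Y)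
    (π : Fin T → stdSimplex ℝ Y) : ℝ :=
  G.maxBenchmark fun p₀ =>
    expect (playLaw L aStar y π fun _ => p₀) fun a₀ =>
      expect (playLaw L aStar y π ψ) fun a =>
        (1 / (T : ℝ)) * ∑ t, (G.V (a₀ t) p₀ (y t) - G.V (a t) (ψ (π t)) (y t))

/-- Policy regret of the mechanism that consists of the forecaster `F` and the rule `ψ`. -/
noncomputable def Game.policyRegret (G : Game P A Y) (aStar : P → stdSimplex ℝ Y → A)
    (F : Forecaster Y) (ψ : stdSimplex ℝ Y → P) (L : AgentAlg P A Y) {T : ℕ}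
    (y : Fin T → Y) : ℝ :=
  expect (forecastLaw F T y) fun π => G.regretGiven aStar ψ L y π

end Finite

/-! Regret notions of the Agent. All suprema and infima are over finitely many bounded values. -/

/-- The Agent's contextual swap regret when his actions have law `μ`. -/
noncomputable def Game.swapReg {P A Y : Type*} (G : Game P A Y) {T : ℕ} (y : Fin T → Y)
    (p : Fin T → P) (r : Fin T → A) (μ : PMF (Fin T → A)) : ℝ :=
  expect μ fun a => ⨆ h : P × A × A → A,
    (1 / (T : ℝ)) * ∑ t, (G.U (h (p t, r t, a t)) (p t) (y t) - G.U (a t) (p t) (y t))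

/-- The gap between the best modification of (policy, recommendation, action) and the best
modification of (policy, recommendation). -/
noncomputable def Game.uGap {P A Y : Type*} (G : Game P A Y) {T : ℕ} (y : Fin T → Y)
    (p : Fin T → P) (r : Fin T → A) (a : Fin T → A) : ℝ :=
  (1 / (T : ℝ)) * ⨆ h : P × A × A → A, ⨅ h' : P × A → A,
    ∑ t, (G.U (h (p t, r t, a t)) (p t) (y t) - G.U (h' (p t, r t)) (p t) (y t))

/-- The Agent's negative cross-swap-regret when his actions have law `μ`. -/
noncomputable def Game.negReg {P A Y : Type*} (G : Game P A Y) {T : ℕ} (y : Fin T → Y)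
    (p : Fin T → P) (r : Fin T → A) (μ : PMF (Fin T → A)) : ℝ :=
  (1 / (T : ℝ)) * expect μ fun a =>
    (∑ t, G.U (a t) (p t) (y t)) - ⨆ h : P × A → A, ∑ t, G.U (h (p t, r t)) (p t) (y t)

section Assumptions

variable {P A Y : Type*} [Fintype Y]

/-- No contextual swap regret, for realized forecasts `π`, under the rule `ψ` and under every
constant mechanism. -/
def Game.NoContextualSwapRegret (G : Game P A Y) (aStar : P → stdSimplex ℝ Y → A)
    (ψ : stdSimplex ℝ Y → P) (L : AgentAlg P A Y) {T : ℕ} (y : Fin T → Y)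
    (π : Fin T → stdSimplex ℝ Y) (εswap : ℝ) : Prop :=
  G.swapReg y (policies ψ π) (recs aStar ψ π) (playLaw L aStar y π ψ) ≤ εswap ∧
  ∀ p₀ ∈ G.P₀, G.swapReg y (fun _ => p₀) (recs aStar (fun _ => p₀) π)
    (playLaw L aStar y π fun _ => p₀) ≤ εswap

/-- Alignment, for realized forecasts `π` and every action sequence that the Agent may play,
under the rule `ψ` and under every constant mechanism. -/
def Game.Alignment (G : Game P A Y) (aStar : P → stdSimplex ℝ Y → A)
    (ψ : stdSimplex ℝ Y → P) (L : AgentAlg P A Y) {T : ℕ} (y : Fin T → Y)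
    (π : Fin T → stdSimplex ℝ Y) (M₁ M₂ : ℝ) : Prop :=
  (∀ a ∈ (playLaw L aStar y π ψ).support,
    (1 / (T : ℝ)) * ∑ t, (G.V (recs aStar ψ π t) (ψ (π t)) (y t) - G.V (a t) (ψ (π t)) (y t)) ≤
      M₁ * G.uGap y (policies ψ π) (recs aStar ψ π) a + M₂) ∧
  ∀ p₀ ∈ G.P₀, ∀ a ∈ (playLaw L aStar y π fun _ => p₀).support,
    (1 / (T : ℝ)) * ∑ t, (G.V (a t) p₀ (y t) - G.V (recs aStar (fun _ => p₀) π t) p₀ (y t)) ≤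
      M₁ * G.uGap y (fun _ => p₀) (recs aStar (fun _ => p₀) π) a + M₂

/-- No negative cross-swap-regret, for realized forecasts `π`, under the rule `ψ` and under every
constant mechanism. -/
def Game.NoNegativeCrossSwapRegret (G : Game P A Y) (aStar : P → stdSimplex ℝ Y → A)
    (ψ : stdSimplex ℝ Y → P) (L : AgentAlg P A Y) {T : ℕ} (y : Fin T → Y)
    (π : Fin T → stdSimplex ℝ Y) (εneg : ℝ) : Prop :=
  G.negReg y (policies ψ π) (recs aStar ψ π) (playLaw L aStar y π ψ) ≤ εneg ∧
  ∀ p₀ ∈ G.P₀, G.negReg y (fun _ => p₀) (recs aStar (fun _ => p₀) π)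
    (playLaw L aStar y π fun _ => p₀) ≤ εneg

end Assumptions

end PrincipalAgent

open PrincipalAgent

/-! The forecaster is built by betting. Each forecast error defines a bet that is fair under the
forecast, and the minimax theorem yields a randomized forecast against which every combination of
such bets gains almost nothing in expectation, whatever the state. The total wealth of finitely many
gamblers therefore stays polynomial in expectation, while a gambler who always bets a fraction of
his capital on an error of fixed sign has wealth exponential in the cumulative error. Hence the
logarithm of the wealth controls all conditional biases at once, at every event count.

For the regret, compare with the play in which the Agent follows the recommendations. The utility
gap of the alignment assumption is in expectation the sum of the swap regret and the negative
cross-swap-regret, so passing to this play costs `M₁ (εswap + εneg) + M₂` on either side. In this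
play, action and policy are constant on each event, so replacing states by forecasts costs at most
the sum of the biases of disjoint events, and under the forecasts `pStar` is optimal. -/

namespace PrincipalAgent

open scoped ENNReal

section Expectation

variable {α β : Type*}

theorem memℓp_infty_of_abs_le {f : α → ℝ} {B : ℝ} (hf : ∀ x, |f x| ≤ B) : Memℓp f ∞ :=
  memℓp_infty ⟨B, Set.forall_mem_range.2 hf⟩

theorem exists_abs_le_of_memℓp_infty {f : α → ℝ} (hf : Memℓp f ∞) : ∃ B, ∀ x, |f x| ≤ B :=
  hf.bddAbove.imp fun _ hB x => hB ⟨x, rfl⟩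

theorem memℓp_infty_const (c : ℝ) : Memℓp (fun _ : α => c) ∞ :=
  memℓp_infty_of_abs_le fun _ => le_rfl

theorem summable_toReal (μ : PMF α) : Summable fun x => (μ x).toReal :=
  ENNReal.summable_toReal μ.tsum_coe_ne_top

theorem summable_toReal_mul (μ : PMF α) {f : α → ℝ} (hf : Memℓp f ∞) :
    Summable fun x => (μ x).toReal * f x := by
  obtain ⟨B, hB⟩ := exists_abs_le_of_memℓp_infty hf
  refine Summable.of_norm_bounded ((summable_toReal μ).mul_right B) fun x => ?_
  rw [Real.norm_eq_abs, abs_mul, ENNReal.abs_toReal]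
  gcongr
  exact hB x

theorem expect_const (μ : PMF α) (c : ℝ) : expect μ (fun _ => c) = c := by
  rw [expect, tsum_mul_right, ← ENNReal.tsum_toReal_eq μ.apply_ne_top, μ.tsum_coe,
    ENNReal.toReal_one, one_mul]

theorem expect_add (μ : PMF α) {f g : α → ℝ} (hf : Memℓp f ∞) (hg : Memℓp g ∞) :
    expect μ (fun x => f x + g x) = expect μ f + expect μ g := by
  simp only [expect, mul_add]
  exact (summable_toReal_mul μ hf).tsum_add (summable_toReal_mul μ hg)

theorem expect_const_mul (μ : PMF α) (c : ℝ) (f : α → ℝ) :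
    expect μ (fun x => c * f x) = c * expect μ f := by
  simp only [expect, mul_left_comm _ c, tsum_mul_left]

theorem expect_mono (μ : PMF α) {f g : α → ℝ} (hf : Memℓp f ∞) (hg : Memℓp g ∞)
    (h : ∀ x ∈ μ.support, f x ≤ g x) : expect μ f ≤ expect μ g := by
  refine (summable_toReal_mul μ hf).tsum_le_tsum (fun x => ?_) (summable_toReal_mul μ hg)
  by_cases hx : x ∈ μ.support
  · exact mul_le_mul_of_nonneg_left (h x hx) ENNReal.toReal_nonneg
  · rw [(μ.apply_eq_zero_iff x).2 hx, ENNReal.toReal_zero, zero_mul, zero_mul]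

theorem expect_le_of_forall_le (μ : PMF α) {f : α → ℝ} {c : ℝ} (hf : Memℓp f ∞)
    (h : ∀ x ∈ μ.support, f x ≤ c) : expect μ f ≤ c :=
  (expect_mono μ hf (memℓp_infty_const c) h).trans_eq (expect_const μ c)

theorem abs_expect_le (μ : PMF α) {f : α → ℝ} {B : ℝ} (hf : ∀ x, |f x| ≤ B) :
    |expect μ f| ≤ B := by
  have hfb := memℓp_infty_of_abs_le hf
  refine abs_le.2 ⟨?_, expect_le_of_forall_le μ hfb fun x _ => (abs_le.1 (hf x)).2⟩
  rw [← expect_const μ (-B)]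
  exact expect_mono μ (memℓp_infty_const _) hfb fun x _ => (abs_le.1 (hf x)).1

theorem memℓp_infty_expect (ν : α → PMF β) {f : β → ℝ} (hf : Memℓp f ∞) :
    Memℓp (fun x => expect (ν x) f) ∞ :=
  let ⟨_, hB⟩ := exists_abs_le_of_memℓp_infty hf
  memℓp_infty_of_abs_le fun x => abs_expect_le (ν x) hB

theorem summable_toReal_mul_toReal (μ : PMF α) (ν : α → PMF β) :
    Summable fun z : α × β => (μ z.1).toReal * (ν z.1 z.2).toReal := by
  simp only [← ENNReal.toReal_mul]
  refine ENNReal.summable_toReal ?_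
  simp [ENNReal.tsum_prod', ENNReal.tsum_mul_left, PMF.tsum_coe]

theorem expect_bind (μ : PMF α) (ν : α → PMF β) {f : β → ℝ} (hf : Memℓp f ∞) :
    expect (μ.bind ν) f = expect μ fun x => expect (ν x) f := by
  obtain ⟨B, hB⟩ := exists_abs_le_of_memℓp_infty hf
  have hbind (z : β) : ((μ.bind ν) z).toReal = ∑' x, (μ x).toReal * (ν x z).toReal := by
    rw [PMF.bind_apply, ENNReal.tsum_toReal_eq fun x =>
      ENNReal.mul_ne_top (μ.apply_ne_top x) ((ν x).apply_ne_top z)]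
    simp only [ENNReal.toReal_mul]
  have hsum : Summable fun z : α × β => (μ z.1).toReal * (ν z.1 z.2).toReal * f z.2 := by
    refine Summable.of_norm_bounded ((summable_toReal_mul_toReal μ ν).mul_right B) fun z => ?_
    rw [Real.norm_eq_abs, abs_mul, abs_of_nonneg (by positivity)]
    gcongr
    exact hB z.2
  simp only [expect, hbind, ← tsum_mul_right, ← tsum_mul_left, ← mul_assoc]
  exact hsum.tsum_comm

theorem expect_pure (x : α) (f : α → ℝ) : expect (PMF.pure x) f = f x := by
  classical
  rw [expect, tsum_eq_single x fun z hz => by simp [hz]]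
  simp

theorem expect_map (μ : PMF α) (e : α → β) {f : β → ℝ} (hf : Memℓp f ∞) :
    expect (μ.map e) f = expect μ fun x => f (e x) := by
  simp only [PMF.map, expect_bind _ _ hf, Function.comp_apply, expect_pure]

theorem expect_log_le (μ : PMF α) {f : α → ℝ} {a : ℝ} (hpos : ∀ x, 0 < f x) (hf : Memℓp f ∞)
    (hlog : Memℓp (fun x => Real.log (f x)) ∞) (ha : 0 < a) (hfa : expect μ f ≤ a) :
    expect μ (fun x => Real.log (f x)) ≤ Real.log a := by
  have htangent (x : α) : Real.log (f x) ≤ (Real.log a - 1) + a⁻¹ * f x := by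
    have h := Real.log_le_sub_one_of_pos (mul_pos (inv_pos.2 ha) (hpos x))
    rw [Real.log_mul (inv_pos.2 ha).ne' (hpos x).ne', Real.log_inv] at h
    linarith
  calc expect μ (fun x => Real.log (f x))
      ≤ expect μ (fun x => (Real.log a - 1) + a⁻¹ * f x) :=
        expect_mono μ hlog ((memℓp_infty_const _).add (hf.const_mul _)) fun x _ => htangent x
    _ = (Real.log a - 1) + a⁻¹ * expect μ f := by
        rw [expect_add μ (memℓp_infty_const _) (hf.const_mul _), expect_const, expect_const_mul]
    _ ≤ (Real.log a - 1) + a⁻¹ * a := by gcongr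
    _ = Real.log a := by rw [inv_mul_cancel₀ ha.ne']; ring

end Expectation

section Minimax

variable {α Y : Type*}

theorem exists_pmf_of_mem_convexHull {g : α → Y → ℝ} (hb : ∀ y, Memℓp (fun a => g a y) ∞)
    {x : Y → ℝ} (hx : x ∈ convexHull ℝ (Set.range g)) :
    ∃ μ : PMF α, ∀ y, expect μ (fun a => g a y) = x y := by
  obtain ⟨ι, _, w, z, hw0, hw1, hz, rfl⟩ := mem_convexHull_iff_exists_fintype.1 hx
  choose e he using hz
  have hsum : ∑ i, ENNReal.ofReal (w i) = 1 := by
    rw [← ENNReal.ofReal_sum_of_nonneg fun i _ => hw0 i, hw1, ENNReal.ofReal_one]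
  refine ⟨(PMF.ofFintype (fun i => ENNReal.ofReal (w i)) hsum).map e, fun y => ?_⟩
  rw [expect_map _ _ (hb y), expect, tsum_fintype, Finset.sum_apply]
  refine Finset.sum_congr rfl fun i _ => ?_
  rw [PMF.ofFintype_apply, ENNReal.toReal_ofReal (hw0 i), he, Pi.smul_apply, smul_eq_mul]

variable [Fintype Y] [Nonempty Y]

theorem exists_pmf_forall_expect_lt {g : α → Y → ℝ} (hb : ∀ y, Memℓp (fun a => g a y) ∞) {v : ℝ}
    (hg : ∀ q ∈ stdSimplex ℝ Y, ∃ a, q ⬝ᵥ g a < v) :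
    ∃ μ : PMF α, ∀ y, expect μ (fun a => g a y) < v := by
  classical
  let gain : (Y → ℝ) →ₗ[ℝ] (Y → ℝ) →ₗ[ℝ] ℝ := -dotProductBilin ℝ ℝ
  have gain_apply (q x : Y → ℝ) : gain q x = -(q ⬝ᵥ x) := rfl
  have hcont_left (x : Y → ℝ) : Continuous fun q => gain q x :=
    (gain.flip x).continuous_of_finiteDimensional
  have hcont_right (q : Y → ℝ) : Continuous (gain q) := (gain q).continuous_of_finiteDimensional
  -- By compactness of the simplex, finitely many responses `s` suffice against every `q`.
  obtain ⟨s, hs⟩ := (isCompact_stdSimplex ℝ Y).elim_finite_subcover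
    (fun a => {q | -v < gain q (g a)}) (fun a => isOpen_lt continuous_const (hcont_left _))
    fun q hq => by simpa [gain_apply] using hg q hq
  obtain ⟨x, hx, hxv⟩ := Sion.exists_lt_iInf_of_lt_iInf_of_finite (f := fun q x => gain q x)
    (t := -v) ⟨_, single_mem_stdSimplex ℝ (Classical.arbitrary Y)⟩ (isCompact_stdSimplex ℝ Y)
    (fun x _ => (hcont_left x).lowerSemicontinuous.lowerSemicontinuousOn _)
    (fun x _ => ((gain.flip x).convexOn (convex_stdSimplex ℝ Y)).quasiconvexOn)
    (convex_convexHull ℝ (Set.range g))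
    (fun q _ => (hcont_right q).upperSemicontinuous.upperSemicontinuousOn _)
    (fun q _ => ((gain q).concaveOn (convex_convexHull ℝ _)).quasiconcaveOn)
    (convex_stdSimplex ℝ Y) (s.finite_toSet.image g)
    ((Set.image_subset_range _ _).trans (subset_convexHull ℝ _))
    (fun q hq => by simpa using hs hq)
  obtain ⟨μ, hμ⟩ := exists_pmf_of_mem_convexHull hb hx
  refine ⟨μ, fun y => ?_⟩
  simpa [gain_apply, hμ] using hxv _ (single_mem_stdSimplex ℝ y)

end Minimax

section Betting

variable {Y : Type*} [Fintype Y]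

/-- A fair bet on the next state: `z q y` is the payoff, per unit of capital, when `q` was
forecast and `y` occurs. Its expectation under the forecast vanishes, and no more than the whole
capital can be lost. -/
structure IsFairBet (z : stdSimplex ℝ Y → Y → ℝ) : Prop where
  dotProduct_eq_zero : ∀ q, q.1 ⬝ᵥ z q = 0
  abs_le_one : ∀ q y, |z q y| ≤ 1

/-- The final capital of a gambler who starts with `1` and bets it on `z` in every round. -/
def wealth (z : stdSimplex ℝ Y → Y → ℝ) {T : ℕ} (y : Fin T → Y) (π : Fin T → stdSimplex ℝ Y) : ℝ :=
  ∏ t, (1 + z (π t) (y t))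

theorem wealth_snoc (z : stdSimplex ℝ Y → Y → ℝ) {T : ℕ} (y : Fin (T + 1) → Y)
    (π : Fin T → stdSimplex ℝ Y) (q : stdSimplex ℝ Y) :
    wealth z y (Fin.snoc (α := fun _ => stdSimplex ℝ Y) π q) =
      wealth z (fun t => y t.castSucc) π * (1 + z q (y (Fin.last T))) := by
  simp only [wealth, Fin.prod_univ_castSucc, Fin.snoc_castSucc, Fin.snoc_last]

theorem IsFairBet.wealth_nonneg {z : stdSimplex ℝ Y → Y → ℝ} (hz : IsFairBet z) {T : ℕ}
    (y : Fin T → Y) (π : Fin T → stdSimplex ℝ Y) : 0 ≤ wealth z y π :=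
  Finset.prod_nonneg fun t _ => by linarith [(abs_le.1 (hz.abs_le_one (π t) (y t))).1]

theorem IsFairBet.memℓp_infty_wealth {z : stdSimplex ℝ Y → Y → ℝ} (hz : IsFairBet z) {T : ℕ}
    (y : Fin T → Y) : Memℓp (wealth z y) ∞ := by
  refine memℓp_infty_of_abs_le (B := ∏ _t : Fin T, 2) fun π => ?_
  rw [wealth, Finset.abs_prod]
  refine Finset.prod_le_prod (fun _ _ => abs_nonneg _) fun t _ => ?_
  obtain ⟨hlower, hupper⟩ := abs_le.1 (hz.abs_le_one (π t) (y t))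
  exact abs_le.2 ⟨by linarith, by linarith⟩

variable {κ : Type*} [Fintype κ] {z : κ → stdSimplex ℝ Y → Y → ℝ}

theorem memℓp_infty_sum_wealth (hz : ∀ j, IsFairBet (z j)) {T : ℕ} (y : Fin T → Y) :
    Memℓp (fun π => ∑ j, wealth (z j) y π) ∞ :=
  Memℓp.finsetSum _ fun j _ => (hz j).memℓp_infty_wealth y

variable [Nonempty Y]

theorem exists_pmf_forall_expect_bets_lt (hz : ∀ j, IsFairBet (z j)) (c : κ → ℝ) {ε : ℝ}
    (hε : 0 < ε) :
    ∃ μ : PMF (stdSimplex ℝ Y), ∀ y, expect μ (fun q => ∑ j, c j * z j q y) < ε := by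
  refine exists_pmf_forall_expect_lt (g := fun q y => ∑ j, c j * z j q y) (fun y => ?_)
    fun q hq => ⟨⟨q, hq⟩, ?_⟩
  · exact Memℓp.finsetSum _ fun j _ =>
      (memℓp_infty_of_abs_le fun q => (hz j).abs_le_one q y).const_mul (c j)
  · have hfair (j : κ) : ∑ y, q y * z j ⟨q, hq⟩ y = 0 := (hz j).dotProduct_eq_zero ⟨q, hq⟩
    simp only [dotProduct, Finset.mul_sum, mul_left_comm _ (c _)]
    rw [Finset.sum_comm]
    simpa only [← Finset.mul_sum, hfair, mul_zero, Finset.sum_const_zero]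

theorem exists_forecaster_expect_sum_wealth_le (hz : ∀ j, IsFairBet (z j)) {ε : ℝ} (hε : 0 < ε) :
    ∃ F : Forecaster Y, ∀ (T : ℕ) (y : Fin T → Y),
      expect (forecastLaw F T y) (fun π => ∑ j, wealth (z j) y π) ≤ Fintype.card κ + T * ε := by
  choose F hF using fun (t : ℕ) (y : Fin t → Y) π =>
    exists_pmf_forall_expect_bets_lt hz (fun j => wealth (z j) y π) hε
  refine ⟨F, fun T => ?_⟩
  induction T with
  | zero => exact fun y => by simp [forecastLaw, expect_pure, wealth]
  | succ T ih =>
    intro y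
    have hW := memℓp_infty_sum_wealth hz y
    have hW' := memℓp_infty_sum_wealth hz fun t => y t.castSucc
    have hstep (π : Fin T → stdSimplex ℝ Y) :
        expect ((F T (fun t => y t.castSucc) π).map fun q =>
          Fin.snoc (α := fun _ => stdSimplex ℝ Y) π q) (fun π' => ∑ j, wealth (z j) y π') ≤
            ∑ j, wealth (z j) (fun t => y t.castSucc) π + ε := by
      rw [expect_map _ _ hW]
      simp only [wealth_snoc, mul_add, mul_one, Finset.sum_add_distrib]
      rw [expect_add _ (memℓp_infty_const _), expect_const]
      · exact add_le_add_right (hF T _ π _).le _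
      · exact Memℓp.finsetSum _ fun j _ =>
          (memℓp_infty_of_abs_le fun q => (hz j).abs_le_one q _).const_mul _
    rw [forecastLaw, expect_bind _ _ hW]
    calc _ ≤ expect (forecastLaw F T fun t => y t.castSucc)
          (fun π => ∑ j, wealth (z j) (fun t => y t.castSucc) π + ε) :=
          expect_mono _ (memℓp_infty_expect _ hW) (hW'.add (memℓp_infty_const ε))
            fun π _ => hstep π
      _ ≤ Fintype.card κ + T * ε + ε := by
          rw [expect_add _ hW' (memℓp_infty_const ε), expect_const]
          exact add_le_add_left (ih _) _
      _ = Fintype.card κ + (T + 1 : ℕ) * ε := by push_cast; ring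

end Betting

section ForecastErrors

variable {Y : Type*}

theorem oneHot_mem_Icc (y k : Y) : oneHot y k ∈ Set.Icc (0 : ℝ) 1 := by
  unfold oneHot
  split_ifs <;> simp

variable [Fintype Y]

theorem dotProduct_oneHot (q : Y → ℝ) (k : Y) : q ⬝ᵥ (oneHot · k) = q k := by
  classical
  simp [dotProduct, oneHot]

/-- The error of the forecast `q` in coordinate `k` when the state is `y`, counted only on the
event `E`. -/
noncomputable def eventError (E : Set (stdSimplex ℝ Y)) (k : Y) (q : stdSimplex ℝ Y) (y : Y) : ℝ :=
  E.indicator (fun q => q.1 k - oneHot y k) q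

theorem abs_eventError_le (E : Set (stdSimplex ℝ Y)) (k : Y) (q : stdSimplex ℝ Y) (y : Y) :
    |eventError E k q y| ≤ E.indicator 1 q := by
  by_cases hq : q ∈ E
  · obtain ⟨hq_nonneg, hq_le⟩ := mem_Icc_of_mem_stdSimplex q.2 k
    obtain ⟨hy_nonneg, hy_le⟩ := oneHot_mem_Icc y k
    simpa [eventError, hq] using abs_sub_le_of_nonneg_of_le hq_nonneg hq_le hy_nonneg hy_le
  · simp [eventError, hq]

theorem abs_eventError_le_one (E : Set (stdSimplex ℝ Y)) (k : Y) (q : stdSimplex ℝ Y) (y : Y) :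
    |eventError E k q y| ≤ 1 :=
  (abs_eventError_le E k q y).trans (Set.indicator_le_self' (fun _ _ => zero_le_one) q)

theorem isFairBet_const_mul_eventError {η : ℝ} (hη : |η| ≤ 1) (E : Set (stdSimplex ℝ Y)) (k : Y) :
    IsFairBet fun q y => η * eventError E k q y where
  dotProduct_eq_zero q := by
    by_cases hq : q ∈ E
    · have hfair : q.1 ⬝ᵥ (η • ((fun _ => q.1 k) - (oneHot · k))) = 0 := by
        rw [dotProduct_smul, dotProduct_sub, dotProduct_oneHot, dotProduct, ← Finset.sum_mul,
          q.2.2, one_mul, sub_self, smul_zero]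
      simp only [eventError, Set.indicator_of_mem hq]
      exact hfair
    · simp [eventError, hq]
  abs_le_one q y := by
    rw [abs_mul]
    exact mul_le_one₀ hη (abs_nonneg _) (abs_eventError_le_one E k q y)

/-- The sum over all rounds of the forecast errors in coordinate `k` on the event `E`. -/
noncomputable def cumError {T : ℕ} (y : Fin T → Y) (π : Fin T → stdSimplex ℝ Y)
    (E : Set (stdSimplex ℝ Y)) (k : Y) : ℝ :=
  ∑ t, eventError E k (π t) (y t)

theorem condBias_eq {T : ℕ} (y : Fin T → Y) (π : Fin T → stdSimplex ℝ Y)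
    (E : Set (stdSimplex ℝ Y)) : condBias y π E = 1 / (T : ℝ) * ∑ k, |cumError y π E k| :=
  rfl

theorem eventCount_eq_sum {T : ℕ} (π : Fin T → stdSimplex ℝ Y) (E : Set (stdSimplex ℝ Y)) :
    (eventCount π E : ℝ) = ∑ t, E.indicator 1 (π t) := by
  classical
  rw [eventCount, Set.ncard_eq_toFinset_card']
  simp [Set.indicator_apply]

theorem eventCount_le {T : ℕ} (π : Fin T → stdSimplex ℝ Y) (E : Set (stdSimplex ℝ Y)) :
    eventCount π E ≤ T := by
  simpa [eventCount] using Set.ncard_le_card {t | π t ∈ E}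

theorem exp_sub_two_mul_sq_le {x : ℝ} (hx : |x| ≤ 1 / 2) : Real.exp (x - 2 * x ^ 2) ≤ 1 + x := by
  have hx' := (abs_le.1 hx).1
  have hexp : Real.exp x ≤ 1 + x + x ^ 2 := by
    linarith [(abs_le.1 (Real.abs_exp_sub_one_sub_id_le (hx.trans (by norm_num)))).2]
  have hexp_sq : 1 + 2 * x ^ 2 ≤ Real.exp (2 * x ^ 2) := by
    linarith [Real.add_one_le_exp (2 * x ^ 2)]
  rw [Real.exp_sub, div_le_iff₀ (Real.exp_pos _)]
  calc Real.exp x ≤ 1 + x + x ^ 2 := hexp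
    _ ≤ (1 + x) * (1 + 2 * x ^ 2) := by nlinarith [sq_nonneg x]
    _ ≤ (1 + x) * Real.exp (2 * x ^ 2) := by gcongr; linarith

theorem exp_cumError_le_wealth {η : ℝ} (hη : |η| ≤ 1 / 2) {T : ℕ} (y : Fin T → Y)
    (π : Fin T → stdSimplex ℝ Y) (E : Set (stdSimplex ℝ Y)) (k : Y) :
    Real.exp (η * cumError y π E k - 2 * η ^ 2 * eventCount π E) ≤
      wealth (fun q y => η * eventError E k q y) y π := by
  rw [cumError, eventCount_eq_sum, Finset.mul_sum, Finset.mul_sum, ← Finset.sum_sub_distrib,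
    Real.exp_sum]
  refine Finset.prod_le_prod (fun _ _ => (Real.exp_pos _).le) fun t _ => ?_
  have herr := abs_eventError_le E k (π t) (y t)
  have herr_one := abs_eventError_le_one E k (π t) (y t)
  have hsq : eventError E k (π t) (y t) ^ 2 ≤ E.indicator 1 (π t) := by
    rw [← sq_abs]
    exact (pow_le_of_le_one (abs_nonneg _) herr_one two_ne_zero).trans herr
  have hbet : |η * eventError E k (π t) (y t)| ≤ 1 / 2 := by
    rw [abs_mul]
    exact (mul_le_of_le_one_right (abs_nonneg η) herr_one).trans hη
  refine le_trans (Real.exp_le_exp.2 ?_) (exp_sub_two_mul_sq_le hbet)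
  rw [mul_pow, ← mul_assoc]
  gcongr

/-- The betting rate suited to an event that occurs `n` times, at the logarithmic scale `l`. -/
noncomputable def learningRate (l n : ℝ) : ℝ :=
  l / (2 * l + √(l * n))

theorem learningRate_pos {l : ℝ} (hl : 0 < l) (n : ℝ) : 0 < learningRate l n := by
  unfold learningRate
  positivity

theorem learningRate_le {l : ℝ} (hl : 0 < l) (n : ℝ) : learningRate l n ≤ 1 / 2 := by
  rw [learningRate, div_le_iff₀ (by positivity)]
  linarith [Real.sqrt_nonneg (l * n)]

theorem learningRate_mul_le {l n : ℝ} (hl : 0 < l) (hn : 0 ≤ n) :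
    learningRate l n * n ≤ √(l * n) := by
  rw [learningRate, div_mul_eq_mul_div, div_le_iff₀ (by positivity)]
  nlinarith [Real.mul_self_sqrt (mul_nonneg hl.le hn), Real.sqrt_nonneg (l * n)]

theorem le_of_learningRate_mul_sub_le {l n x L : ℝ} (hl : 0 < l) (hn : 0 ≤ n) (hL : 0 ≤ L)
    (h : learningRate l n * x - 2 * learningRate l n ^ 2 * n ≤ L) :
    x ≤ (l + √(l * n)) * (2 / l * L + 2) := by
  have hη := learningRate_pos hl n
  have hinv : L / learningRate l n = L * (2 * l + √(l * n)) / l := by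
    rw [learningRate, div_div_eq_mul_div]
  calc x ≤ L / learningRate l n + 2 * (learningRate l n * n) := by
        rw [← sub_le_iff_le_add, le_div_iff₀ hη]
        linarith
    _ ≤ L * (2 * l + √(l * n)) / l + 2 * √(l * n) := by
        rw [hinv]
        gcongr
        exact learningRate_mul_le hl hn
    _ ≤ L * (2 * l + √(l * n)) / l + 2 * √(l * n) + (L * √(l * n) / l + 2 * l) :=
        le_add_of_nonneg_right (by positivity)
    _ = (l + √(l * n)) * (2 / l * L + 2) := by field_simp; ring

end ForecastErrors

section UnbiasedForecaster

/-- The logarithmic factor `ℓ` in the rate `biasRate` for `m` events over the horizon `T`. -/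
noncomputable def logSize (Y : Type*) [Fintype Y] (m T : ℕ) : ℝ :=
  Real.log (Fintype.card Y * m * T)

variable {Y : Type*} [Fintype Y]

theorem logSize_nonneg (m T : ℕ) : 0 ≤ logSize Y m T := by
  unfold logSize
  exact_mod_cast Real.log_natCast_nonneg _

theorem logSize_pos {m T : ℕ} (hM : 1 < Fintype.card Y * m * T) : 0 < logSize Y m T :=
  Real.log_pos (by exact_mod_cast hM)

theorem biasRate_eq (m : ℕ) {T : ℕ} (π : Fin T → stdSimplex ℝ Y) (E : Set (stdSimplex ℝ Y)) :
    biasRate m π E =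
      1 / (T : ℝ) * (Fintype.card Y * (logSize Y m T + √(logSize Y m T * eventCount π E))) := by
  rw [biasRate, logSize]
  ring

theorem biasRate_nonneg (m : ℕ) {T : ℕ} (π : Fin T → stdSimplex ℝ Y) (E : Set (stdSimplex ℝ Y)) :
    0 ≤ biasRate m π E := by
  have := logSize_nonneg (Y := Y) m T
  rw [biasRate_eq]
  positivity

theorem biasRate_pos {m T : ℕ} (hM : 1 < Fintype.card Y * m * T) (π : Fin T → stdSimplex ℝ Y)
    (E : Set (stdSimplex ℝ Y)) : 0 < biasRate m π E := by
  have hl := logSize_pos hM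
  have hYm : 0 < Fintype.card Y * m := pos_of_mul_pos_left (zero_le_one.trans_lt hM) T.zero_le
  have hT : 0 < T := pos_of_mul_pos_right (zero_le_one.trans_lt hM) (Nat.zero_le _)
  have hY : 0 < Fintype.card Y := pos_of_mul_pos_left hYm m.zero_le
  rw [biasRate_eq]
  positivity

theorem condBias_nonneg {T : ℕ} (y : Fin T → Y) (π : Fin T → stdSimplex ℝ Y)
    (E : Set (stdSimplex ℝ Y)) : 0 ≤ condBias y π E := by
  rw [condBias_eq]
  positivity

theorem condBias_div_biasRate_le {m T : ℕ} {y : Fin T → Y} {π : Fin T → stdSimplex ℝ Y}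
    {E : Set (stdSimplex ℝ Y)} {R : ℝ} (hR : 0 ≤ R)
    (h : ∀ k, |cumError y π E k| ≤ (logSize Y m T + √(logSize Y m T * eventCount π E)) * R) :
    condBias y π E / biasRate m π E ≤ R := by
  refine div_le_of_le_mul₀ (biasRate_nonneg m π E) hR ?_
  rw [condBias_eq, biasRate_eq, mul_left_comm]
  gcongr
  refine (Finset.sum_le_card_nsmul _ _ _ fun k _ => h k).trans_eq ?_
  rw [Finset.card_univ, nsmul_eq_mul]
  ring

variable {ι : Type*} [Fintype ι]

/-- The quantity whose expectation `IsUnbiasedForecaster` bounds: the largest ratio of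
conditional bias to `biasRate` over the family `E` of events. -/
noncomputable def maxBiasRatio {T : ℕ} (y : Fin T → Y) (E : ι → Set (stdSimplex ℝ Y))
    (π : Fin T → stdSimplex ℝ Y) : ℝ :=
  ⨆ i, condBias y π (E i) / biasRate (Fintype.card ι) π (E i)

theorem maxBiasRatio_nonneg {T : ℕ} (y : Fin T → Y) (E : ι → Set (stdSimplex ℝ Y))
    (π : Fin T → stdSimplex ℝ Y) : 0 ≤ maxBiasRatio y E π :=
  Real.iSup_nonneg fun _ => div_nonneg (condBias_nonneg _ _ _) (biasRate_nonneg _ _ _)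

theorem condBias_le_maxBiasRatio_mul {T : ℕ} (hM : 1 < Fintype.card Y * Fintype.card ι * T)
    (y : Fin T → Y) (E : ι → Set (stdSimplex ℝ Y)) (π : Fin T → stdSimplex ℝ Y) (i : ι) :
    condBias y π (E i) ≤ maxBiasRatio y E π * biasRate (Fintype.card ι) π (E i) :=
  (div_le_iff₀ (biasRate_pos hM π (E i))).1 (le_ciSup (f := fun i =>
    condBias y π (E i) / biasRate (Fintype.card ι) π (E i)) (Set.finite_range _).bddAbove i)

/-- The bets used to control all the forecast errors on the events `E i` at once: one for each
event, each coordinate, each guess of the event count, and each sign of the error. -/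
noncomputable def errorBet (E : ι → Set (stdSimplex ℝ Y)) (T : ℕ)
    (j : ι × Y × Fin (T + 1) × SignType) (q : stdSimplex ℝ Y) (y : Y) : ℝ :=
  j.2.2.2 * learningRate (logSize Y (Fintype.card ι) T) (j.2.2.1 : ℕ) * eventError (E j.1) j.2.1 q y

/-- The joint final capital of the gamblers with the bets `errorBet`. -/
noncomputable def totalWealth (E : ι → Set (stdSimplex ℝ Y)) {T : ℕ} (y : Fin T → Y)
    (π : Fin T → stdSimplex ℝ Y) : ℝ :=
  ∑ j, wealth (errorBet E T j) y π

theorem abs_sign_mul_learningRate_le (σ : SignType) {l : ℝ} (hl : 0 < l) (n : ℝ) :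
    |σ * learningRate l n| ≤ 1 / 2 := by
  have hpos := learningRate_pos hl n
  have hle := learningRate_le hl n
  cases σ <;> simp [abs_of_pos hpos] <;> linarith

theorem isFairBet_errorBet {T : ℕ} (hM : 1 < Fintype.card Y * Fintype.card ι * T)
    (E : ι → Set (stdSimplex ℝ Y)) (j : ι × Y × Fin (T + 1) × SignType) :
    IsFairBet (errorBet E T j) :=
  isFairBet_const_mul_eventError
    ((abs_sign_mul_learningRate_le j.2.2.2 (logSize_pos hM) _).trans (by norm_num)) _ _

theorem totalWealth_nonneg {T : ℕ} (hM : 1 < Fintype.card Y * Fintype.card ι * T)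
    (E : ι → Set (stdSimplex ℝ Y)) (y : Fin T → Y) (π : Fin T → stdSimplex ℝ Y) :
    0 ≤ totalWealth E y π :=
  Finset.sum_nonneg fun j _ => (isFairBet_errorBet hM E j).wealth_nonneg y π

theorem abs_cumError_le_log_totalWealth {T : ℕ}
    (hM : 1 < Fintype.card Y * Fintype.card ι * T) (y : Fin T → Y)
    (E : ι → Set (stdSimplex ℝ Y)) (π : Fin T → stdSimplex ℝ Y) (i : ι) (k : Y) :
    |cumError y π (E i) k| ≤
      (logSize Y (Fintype.card ι) T +
        √(logSize Y (Fintype.card ι) T * eventCount π (E i))) *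
      (2 / logSize Y (Fintype.card ι) T * Real.log (1 + totalWealth E y π) + 2) := by
  have hl := logSize_pos hM
  set l := logSize Y (Fintype.card ι) T
  set n := eventCount π (E i)
  have hW := totalWealth_nonneg hM E y π
  refine le_of_learningRate_mul_sub_le hl n.cast_nonneg (Real.log_nonneg (by linarith)) ?_
  rw [Real.le_log_iff_exp_le (by linarith)]
  set σ := SignType.sign (cumError y π (E i) k) with hσ
  have hσ_sq : (σ : ℝ) ^ 2 ≤ 1 := by cases σ <;> simp
  have hwealth : wealth (errorBet E T (i, k, ⟨n, Nat.lt_succ_of_le (eventCount_le π _)⟩, σ)) y π ≤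
      totalWealth E y π :=
    Finset.single_le_sum (f := fun j => wealth (errorBet E T j) y π)
      (fun j _ => (isFairBet_errorBet hM E j).wealth_nonneg y π) (Finset.mem_univ _)
  calc Real.exp (learningRate l n * |cumError y π (E i) k| - 2 * learningRate l n ^ 2 * n)
      ≤ Real.exp (σ * learningRate l n * cumError y π (E i) k -
          2 * (σ * learningRate l n) ^ 2 * n) := by
        rw [← sign_mul_self, ← hσ, mul_pow, mul_right_comm (σ : ℝ), mul_comm (learningRate l n)]
        gcongr
        exact mul_le_of_le_one_left (sq_nonneg _) hσ_sq
    _ ≤ wealth (errorBet E T (i, k, ⟨n, Nat.lt_succ_of_le (eventCount_le π _)⟩, σ)) y π :=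
        exp_cumError_le_wealth (abs_sign_mul_learningRate_le σ hl n) y π (E i) k
    _ ≤ 1 + totalWealth E y π := by linarith

theorem maxBiasRatio_le_log_totalWealth {T : ℕ} (hM : 1 < Fintype.card Y * Fintype.card ι * T)
    (y : Fin T → Y) (E : ι → Set (stdSimplex ℝ Y)) (π : Fin T → stdSimplex ℝ Y) :
    maxBiasRatio y E π ≤
      2 / logSize Y (Fintype.card ι) T * Real.log (1 + totalWealth E y π) + 2 := by
  have hlog := Real.log_nonneg (le_add_of_nonneg_right (totalWealth_nonneg hM E y π))
  have hl := logSize_nonneg (Y := Y) (Fintype.card ι) T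
  have hbound : 0 ≤ 2 / logSize Y (Fintype.card ι) T * Real.log (1 + totalWealth E y π) + 2 := by
    positivity
  exact Real.iSup_le (fun i => condBias_div_biasRate_le hbound fun k =>
    abs_cumError_le_log_totalWealth hM y E π i k) hbound

theorem memℓp_infty_totalWealth {T : ℕ} (hM : 1 < Fintype.card Y * Fintype.card ι * T)
    (y : Fin T → Y) (E : ι → Set (stdSimplex ℝ Y)) : Memℓp (totalWealth E y) ∞ :=
  memℓp_infty_sum_wealth (isFairBet_errorBet hM E) y

theorem memℓp_infty_log_totalWealth {T : ℕ} (hM : 1 < Fintype.card Y * Fintype.card ι * T)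
    (y : Fin T → Y) (E : ι → Set (stdSimplex ℝ Y)) :
    Memℓp (fun π => Real.log (1 + totalWealth E y π)) ∞ := by
  obtain ⟨B, hB⟩ := exists_abs_le_of_memℓp_infty (memℓp_infty_totalWealth hM y E)
  refine memℓp_infty_of_abs_le (B := B) fun π => ?_
  have hW := totalWealth_nonneg hM E y π
  rw [abs_of_nonneg (Real.log_nonneg (by linarith))]
  calc Real.log (1 + totalWealth E y π) ≤ 1 + totalWealth E y π - 1 :=
        Real.log_le_sub_one_of_pos (by linarith)
    _ = totalWealth E y π := by ring
    _ ≤ B := (le_abs_self _).trans (hB π)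

theorem memℓp_infty_maxBiasRatio {T : ℕ} (hM : 1 < Fintype.card Y * Fintype.card ι * T)
    (y : Fin T → Y) (E : ι → Set (stdSimplex ℝ Y)) : Memℓp (maxBiasRatio y E) ∞ := by
  obtain ⟨B, hB⟩ := exists_abs_le_of_memℓp_infty (((memℓp_infty_log_totalWealth hM y E).const_mul
    (2 / logSize Y (Fintype.card ι) T)).add (memℓp_infty_const 2))
  refine memℓp_infty_of_abs_le (B := B) fun π => ?_
  rw [abs_of_nonneg (maxBiasRatio_nonneg y E π)]
  exact (maxBiasRatio_le_log_totalWealth hM y E π).trans ((le_abs_self _).trans (hB π))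

theorem exists_forecaster_expect_totalWealth_le {T : ℕ}
    (hM : 1 < Fintype.card Y * Fintype.card ι * T) (E : ι → Set (stdSimplex ℝ Y)) :
    ∃ F : Forecaster Y, ∀ y : Fin T → Y, expect (forecastLaw F T y) (totalWealth E y) ≤
      7 * (Fintype.card Y * Fintype.card ι * T) := by
  have hYm : 0 < Fintype.card Y * Fintype.card ι :=
    pos_of_mul_pos_left (zero_le_one.trans_lt hM) T.zero_le
  have hT : 0 < T := pos_of_mul_pos_right (zero_le_one.trans_lt hM) (Nat.zero_le _)
  have : Nonempty Y := Fintype.card_pos_iff.1 (pos_of_mul_pos_left hYm (Nat.zero_le _))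
  obtain ⟨F, hF⟩ := exists_forecaster_expect_sum_wealth_le (isFairBet_errorBet hM E) one_pos
  refine ⟨F, fun y => (hF T y).trans ?_⟩
  have hcard : Fintype.card (ι × Y × Fin (T + 1) × SignType) + T ≤
      7 * (Fintype.card Y * Fintype.card ι * T) := by
    simp only [Fintype.card_prod, Fintype.card_fin, show Fintype.card SignType = 3 from rfl]
    nlinarith [Nat.le_mul_of_pos_left T hYm,
      Nat.le_mul_of_pos_right (Fintype.card Y * Fintype.card ι) hT]
  rw [mul_one]
  exact_mod_cast hcard

theorem exists_isUnbiasedForecaster {T : ℕ} (hM : 1 < Fintype.card Y * Fintype.card ι * T)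
    (E : ι → Set (stdSimplex ℝ Y)) : ∃ F : Forecaster Y, IsUnbiasedForecaster 10 F T E := by
  obtain ⟨F, hF⟩ := exists_forecaster_expect_totalWealth_le hM E
  refine ⟨F, fun y => ?_⟩
  have hW := memℓp_infty_totalWealth hM y E
  have hlogW := memℓp_infty_log_totalWealth hM y E
  have hl := logSize_pos hM
  set l := logSize Y (Fintype.card ι) T with hl_def
  have hM2 : (2 : ℝ) ≤ Fintype.card Y * Fintype.card ι * T := by
    exact_mod_cast (show 2 ≤ Fintype.card Y * Fintype.card ι * T from hM)
  set M : ℝ := Fintype.card Y * Fintype.card ι * T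
  have hlog : expect (forecastLaw F T y) (fun π => Real.log (1 + totalWealth E y π)) ≤ 4 * l := by
    have hmean : expect (forecastLaw F T y) (fun π => 1 + totalWealth E y π) ≤ M ^ 4 := by
      rw [expect_add _ (memℓp_infty_const 1) hW, expect_const]
      nlinarith [hF y, pow_le_pow_left₀ zero_le_two hM2 3]
    refine (expect_log_le _ (fun π => ?_) ((memℓp_infty_const 1).add hW) hlogW (by positivity)
      hmean).trans_eq ?_
    · exact add_pos_of_pos_of_nonneg one_pos (totalWealth_nonneg hM E y π)
    · rw [Real.log_pow, hl_def, logSize, Nat.cast_ofNat]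
  calc expect (forecastLaw F T y) (maxBiasRatio y E)
      ≤ expect (forecastLaw F T y) (fun π => 2 / l * Real.log (1 + totalWealth E y π) + 2) :=
        expect_mono _ (memℓp_infty_maxBiasRatio hM y E)
          ((hlogW.const_mul _).add (memℓp_infty_const 2))
          fun π _ => maxBiasRatio_le_log_totalWealth hM y E π
    _ = 2 / l * expect (forecastLaw F T y) (fun π => Real.log (1 + totalWealth E y π)) + 2 := by
        rw [expect_add _ (hlogW.const_mul _) (memℓp_infty_const 2), expect_const_mul, expect_const]
    _ ≤ 2 / l * (4 * l) + 2 := by gcongr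
    _ = 10 := by field_simp; norm_num

end UnbiasedForecaster

theorem abs_mean_le {T : ℕ} {f : Fin T → ℝ} {B : ℝ} (hB : 0 ≤ B) (hf : ∀ t, |f t| ≤ B) :
    |1 / (T : ℝ) * ∑ t, f t| ≤ B := by
  have hsum : |∑ t, f t| ≤ B * T :=
    (Finset.abs_sum_le_sum_abs _ _).trans
      ((Finset.sum_le_card_nsmul _ _ _ fun t _ => hf t).trans (by simp [mul_comm]))
  rw [one_div_mul_eq_div, abs_div, Nat.abs_cast]
  exact div_le_of_le_mul₀ T.cast_nonneg hB hsum

theorem sub_ciSup {ι : Type*} [Nonempty ι] {f : ι → ℝ} (hf : BddAbove (Set.range f)) (a : ℝ) :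
    a - ⨆ i, f i = ⨅ i, (a - f i) :=
  (OrderIso.subLeft a).map_ciSup hf

section Agent

variable {P A Y : Type*} (G : Game P A Y)

theorem Game.abs_V_sub_V_le (a b : A) (p q : P) (y : Y) : |G.V a p y - G.V b q y| ≤ 2 := by
  obtain ⟨ha_lower, ha_upper⟩ := G.V_mem a p y
  obtain ⟨hb_lower, hb_upper⟩ := G.V_mem b q y
  exact abs_le.2 ⟨by linarith, by linarith⟩

theorem Game.bddAbove_sum_U {T : ℕ} {H : Type*} (y : Fin T → Y) (p : Fin T → P)
    (b : H → Fin T → A) : BddAbove (Set.range fun h => ∑ t, G.U (b h t) (p t) (y t)) :=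
  ⟨∑ _t : Fin T, 1, Set.forall_mem_range.2 fun _ =>
    Finset.sum_le_sum fun _ _ => (G.U_mem _ _ _).2⟩

theorem Game.uGap_eq [Nonempty A] {T : ℕ} (y : Fin T → Y) (p : Fin T → P) (r a : Fin T → A) :
    G.uGap y p r a =
      (⨆ h : P × A × A → A,
        (1 / (T : ℝ)) * ∑ t, (G.U (h (p t, r t, a t)) (p t) (y t) - G.U (a t) (p t) (y t))) +
      1 / (T : ℝ) * ((∑ t, G.U (a t) (p t) (y t)) -
        ⨆ h : P × A → A, ∑ t, G.U (h (p t, r t)) (p t) (y t)) := by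
  have hswap := G.bddAbove_sum_U y p fun (h : P × A × A → A) t => h (p t, r t, a t)
  have hcross := G.bddAbove_sum_U y p fun (h : P × A → A) t => h (p t, r t)
  simp only [Game.uGap, Finset.sum_sub_distrib]
  rw [← Real.mul_iSup_of_nonneg (by positivity), ← ciSup_sub hswap]
  simp only [← sub_ciSup hcross]
  rw [← ciSup_sub hswap]
  ring

theorem Game.expect_uGap [Finite A] [Nonempty A] {T : ℕ} (y : Fin T → Y) (p : Fin T → P)
    (r : Fin T → A) (μ : PMF (Fin T → A)) :
    expect μ (G.uGap y p r) = G.swapReg y p r μ + G.negReg y p r μ := by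
  rw [Game.swapReg, Game.negReg, ← expect_const_mul, ← expect_add _ (.all _) (.all _)]
  exact congrArg (expect μ) (funext (G.uGap_eq y p r))

theorem Game.expect_le_of_alignment [Finite A] [Nonempty A] {T : ℕ} {y : Fin T → Y}
    {p : Fin T → P} {r : Fin T → A} {μ : PMF (Fin T → A)} {f : (Fin T → A) → ℝ}
    {M₁ M₂ εswap εneg : ℝ} (hM : 0 ≤ M₁) (hswap : G.swapReg y p r μ ≤ εswap)
    (hneg : G.negReg y p r μ ≤ εneg) (hf : ∀ a ∈ μ.support, f a ≤ M₁ * G.uGap y p r a + M₂) :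
    expect μ f ≤ M₁ * (εswap + εneg) + M₂ :=
  calc expect μ f ≤ expect μ (fun a => M₁ * G.uGap y p r a + M₂) :=
        expect_mono _ (.all _) (.all _) hf
    _ = M₁ * (G.swapReg y p r μ + G.negReg y p r μ) + M₂ := by
        rw [expect_add _ (.all _) (.all _), expect_const_mul, G.expect_uGap, expect_const]
    _ ≤ M₁ * (εswap + εneg) + M₂ := by gcongr

end Agent

section LevelSets

variable {Y : Type*} [Fintype Y] {κ : Type*} [Fintype κ] {E : κ → Set (stdSimplex ℝ Y)}
  {c : stdSimplex ℝ Y → κ}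

theorem sum_eventCount (hE : ∀ q j, q ∈ E j ↔ c q = j) {T : ℕ} (π : Fin T → stdSimplex ℝ Y) :
    ∑ j, (eventCount π (E j) : ℝ) = T := by
  classical
  simp only [eventCount_eq_sum, Set.indicator_apply, hE]
  rw [Finset.sum_comm]
  simp

theorem sum_sqrt_eventCount_le (hE : ∀ q j, q ∈ E j ↔ c q = j) {T : ℕ}
    (π : Fin T → stdSimplex ℝ Y) {l : ℝ} (hl : 0 ≤ l) :
    ∑ j, √(l * eventCount π (E j)) ≤ T * √(l * Fintype.card κ / T) := by
  have hsq : ∑ j, √(l * eventCount π (E j)) ^ 2 = l * T := by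
    rw [← sum_eventCount hE π, Finset.mul_sum]
    exact Finset.sum_congr rfl fun j _ => Real.sq_sqrt (by positivity)
  calc ∑ j, √(l * eventCount π (E j)) ≤ √(Fintype.card κ * (l * T)) :=
        Real.le_sqrt_of_sq_le (sq_sum_le_card_mul_sum_sq.trans_eq (by rw [hsq, Finset.card_univ]))
    _ = √(T ^ 2 * (l * Fintype.card κ / T)) := by
        congr 1
        field_simp
    _ = T * √(l * Fintype.card κ / T) := by
        rw [Real.sqrt_mul (sq_nonneg _), Real.sqrt_sq T.cast_nonneg]

/-- An upper bound for the sum of `biasRate m` over `n` disjoint events, used to control all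
level sets of a function of the forecast together. -/
noncomputable def totalRate (Y : Type*) [Fintype Y] (m n T : ℕ) : ℝ :=
  Fintype.card Y * (logSize Y m T * n / T + √(logSize Y m T * n / T))

theorem totalRate_nonneg (m n T : ℕ) : 0 ≤ totalRate Y m n T := by
  have hl := logSize_nonneg (Y := Y) m T
  unfold totalRate
  positivity

theorem totalRate_mono (m T : ℕ) : Monotone fun n => totalRate Y m n T := fun a b hab => by
  have hl := logSize_nonneg (Y := Y) m T
  dsimp only [totalRate]
  gcongr

theorem sum_biasRate_le (hE : ∀ q j, q ∈ E j ↔ c q = j) (m : ℕ) {T : ℕ}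
    (π : Fin T → stdSimplex ℝ Y) :
    ∑ j, biasRate m π (E j) ≤ totalRate Y m (Fintype.card κ) T := by
  have hl := logSize_nonneg (Y := Y) m T
  simp only [biasRate_eq, totalRate]
  rw [← Finset.mul_sum, ← Finset.mul_sum, Finset.sum_add_distrib, Finset.sum_const,
    Finset.card_univ, nsmul_eq_mul]
  set l := logSize Y m T
  calc 1 / (T : ℝ) * (Fintype.card Y *
        (Fintype.card κ * l + ∑ j, √(l * eventCount π (E j))))
      ≤ 1 / (T : ℝ) * (Fintype.card Y *
          (Fintype.card κ * l + T * √(l * Fintype.card κ / T))) := by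
        gcongr
        exact sum_sqrt_eventCount_le hE π hl
    _ = Fintype.card Y * (l * Fintype.card κ / T + √(l * Fintype.card κ / T)) := by
        rcases T.eq_zero_or_pos with rfl | hT
        · simp
        · field_simp

theorem dotProduct_sub_eq_sum_eventError (hE : ∀ q j, q ∈ E j ↔ c q = j) (w : κ → Y → ℝ)
    (q : stdSimplex ℝ Y) (y : Y) :
    q.1 ⬝ᵥ w (c q) - w (c q) y = ∑ j, ∑ k, eventError (E j) k q y * w j k := by
  classical
  rw [Finset.sum_eq_single (c q)]
  · have hy : oneHot y ⬝ᵥ w (c q) = w (c q) y := by simp [dotProduct, oneHot]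
    rw [← hy, ← sub_dotProduct]
    simp [dotProduct, eventError, (hE q (c q)).2 rfl]
  · intro j _ hj
    have hq : q ∉ E j := fun hq => hj ((hE q j).1 hq).symm
    simp [eventError, hq]
  · simp

theorem abs_mean_sub_le_sum_condBias (hE : ∀ q j, q ∈ E j ↔ c q = j) {w : κ → Y → ℝ}
    (hw : ∀ j k, |w j k| ≤ 1) {T : ℕ} (y : Fin T → Y) (π : Fin T → stdSimplex ℝ Y) :
    |1 / (T : ℝ) * ∑ t, ((π t).1 ⬝ᵥ w (c (π t)) - w (c (π t)) (y t))| ≤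
      ∑ j, condBias y π (E j) := by
  have hswap : ∑ t, ((π t).1 ⬝ᵥ w (c (π t)) - w (c (π t)) (y t)) =
      ∑ j, ∑ k, cumError y π (E j) k * w j k := by
    simp only [dotProduct_sub_eq_sum_eventError hE, cumError, Finset.sum_mul]
    rw [Finset.sum_comm]
    exact Finset.sum_congr rfl fun j _ => Finset.sum_comm
  rw [hswap, abs_mul, abs_of_nonneg (by positivity : (0 : ℝ) ≤ 1 / T)]
  simp only [condBias_eq, ← Finset.mul_sum]
  gcongr
  refine (Finset.abs_sum_le_sum_abs _ _).trans (Finset.sum_le_sum fun j _ => ?_)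
  refine (Finset.abs_sum_le_sum_abs _ _).trans (Finset.sum_le_sum fun k _ => ?_)
  rw [abs_mul]
  exact mul_le_of_le_one_right (abs_nonneg _) (hw j k)

theorem abs_mean_sub_le_mul_totalRate (hE : ∀ q j, q ∈ E j ↔ c q = j) {w : κ → Y → ℝ}
    (hw : ∀ j k, |w j k| ≤ 1) {T m : ℕ} {y : Fin T → Y} {π : Fin T → stdSimplex ℝ Y} {R : ℝ}
    (hR : 0 ≤ R) (hbias : ∀ j, condBias y π (E j) ≤ R * biasRate m π (E j)) :
    |1 / (T : ℝ) * ∑ t, ((π t).1 ⬝ᵥ w (c (π t)) - w (c (π t)) (y t))| ≤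
      R * totalRate Y m (Fintype.card κ) T :=
  calc _ ≤ ∑ j, condBias y π (E j) := abs_mean_sub_le_sum_condBias hE hw y π
    _ ≤ ∑ j, R * biasRate m π (E j) := Finset.sum_le_sum fun j _ => hbias j
    _ = R * ∑ j, biasRate m π (E j) := (Finset.mul_sum _ _ _).symm
    _ ≤ R * totalRate Y m (Fintype.card κ) T := by
        gcongr
        exact sum_biasRate_le hE m π

theorem min_two_mul_totalRate_le [Nonempty Y] {K : ℝ} (hK : 0 ≤ K) (m n T : ℕ) :
    min 2 (2 * K * totalRate Y m n T) ≤
      (4 * K + 2) * (Fintype.card Y * √(n / T) * √(logSize Y m T)) := by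
  have hl := logSize_nonneg (Y := Y) m T
  have hY : (1 : ℝ) ≤ Fintype.card Y := by exact_mod_cast Fintype.card_pos (α := Y)
  have hsqrt : √(n / T) * √(logSize Y m T) = √(logSize Y m T * n / T) := by
    rw [← Real.sqrt_mul (by positivity)]
    congr 1
    ring
  rw [mul_assoc (Fintype.card Y : ℝ), hsqrt, totalRate]
  have hs : 0 ≤ logSize Y m T * n / T := by positivity
  set s := logSize Y m T * n / T
  rcases le_total s 1 with hs_le | hs_ge
  · have hs_sqrt : s ≤ √s := Real.le_sqrt_of_sq_le (by nlinarith)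
    calc min 2 (2 * K * (Fintype.card Y * (s + √s)))
        ≤ 2 * K * (Fintype.card Y * (√s + √s)) := (min_le_right _ _).trans (by gcongr)
      _ = 4 * K * (Fintype.card Y * √s) := by ring
      _ ≤ (4 * K + 2) * (Fintype.card Y * √s) := by gcongr; linarith
  · have hone : 1 ≤ Fintype.card Y * √s :=
      one_le_mul_of_one_le_of_one_le hY (Real.one_le_sqrt.2 hs_ge)
    calc min 2 (2 * K * (Fintype.card Y * (s + √s)))
        ≤ 2 * 1 := (min_le_left _ _).trans (by norm_num)
      _ ≤ (4 * K + 2) * (Fintype.card Y * √s) := by gcongr; linarith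

end LevelSets

theorem Game.card_events {P A Y : Type*} [Fintype A] (G : Game P A Y) :
    Fintype.card ((G.P₀ × A) ⊕ (G.P₀ × A)) = 2 * (G.P₀.card * Fintype.card A) := by
  rw [Fintype.card_sum, Fintype.card_prod, Fintype.card_coe, two_mul]

section Regret

variable {P A Y : Type*} [Fintype Y] (G : Game P A Y) {aStar : P → stdSimplex ℝ Y → A}
  {pStar : stdSimplex ℝ Y → P}

theorem Game.memℓp_infty_regretGiven (aStar : P → stdSimplex ℝ Y → A) (ψ : stdSimplex ℝ Y → P)
    (L : AgentAlg P A Y) {T : ℕ} (y : Fin T → Y) :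
    Memℓp (fun π => G.regretGiven aStar ψ L y π) ∞ := by
  refine memℓp_infty_of_abs_le (B := 2) fun π => ?_
  have hbound (p₀ : P) : |expect (playLaw L aStar y π fun _ => p₀) fun a₀ =>
      expect (playLaw L aStar y π ψ) fun a =>
        (1 / (T : ℝ)) * ∑ t, (G.V (a₀ t) p₀ (y t) - G.V (a t) (ψ (π t)) (y t))| ≤ 2 :=
    abs_expect_le _ fun a₀ => abs_expect_le _ fun a =>
      abs_mean_le zero_le_two fun t => G.abs_V_sub_V_le _ _ _ _ _
  obtain ⟨p₀, hp₀⟩ := G.P₀_nonempty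
  unfold Game.regretGiven Game.maxBenchmark
  exact abs_le.2 ⟨Finset.le_sup'_of_le _ hp₀ (abs_le.1 (hbound p₀)).1,
    Finset.sup'_le _ _ fun p _ => (abs_le.1 (hbound p)).2⟩

/-- The Principal's regret against the benchmark `p₀` in the hypothetical play in which the Agent
follows every recommendation. -/
noncomputable def Game.recRegret (G : Game P A Y) (aStar : P → stdSimplex ℝ Y → A)
    (ψ : stdSimplex ℝ Y → P) {T : ℕ} (y : Fin T → Y) (π : Fin T → stdSimplex ℝ Y) (p₀ : P) : ℝ :=
  1 / (T : ℝ) * ∑ t, (G.V (aStar p₀ (π t)) p₀ (y t) -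
    G.V (aStar (ψ (π t)) (π t)) (ψ (π t)) (y t))

theorem Game.recRegret_le_two (ψ : stdSimplex ℝ Y → P) {T : ℕ} (y : Fin T → Y)
    (π : Fin T → stdSimplex ℝ Y) (p₀ : P) : G.recRegret aStar ψ y π p₀ ≤ 2 :=
  (abs_le.1 (abs_mean_le zero_le_two fun _ => G.abs_V_sub_V_le _ _ _ _ _)).2

theorem Game.regretGiven_le [Finite A] [Nonempty A] {ψ : stdSimplex ℝ Y → P}
    {L : AgentAlg P A Y} {T : ℕ} {y : Fin T → Y} {π : Fin T → stdSimplex ℝ Y}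
    {εswap εneg M₁ M₂ R : ℝ} (hM : 0 ≤ M₁)
    (hswap : G.NoContextualSwapRegret aStar ψ L y π εswap)
    (halign : G.Alignment aStar ψ L y π M₁ M₂)
    (hneg : G.NoNegativeCrossSwapRegret aStar ψ L y π εneg)
    (hR : ∀ p₀ ∈ G.P₀, G.recRegret aStar ψ y π p₀ ≤ R) :
    G.regretGiven aStar ψ L y π ≤ R + 2 * (M₁ * (εswap + εneg) + M₂) := by
  unfold Game.regretGiven Game.maxBenchmark
  refine Finset.sup'_le _ _ fun p₀ hp₀ => ?_
  have hmech := G.expect_le_of_alignment hM hswap.1 hneg.1 halign.1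
  have hconst := G.expect_le_of_alignment hM (hswap.2 p₀ hp₀) (hneg.2 p₀ hp₀) (halign.2 p₀ hp₀)
  have hsplit (a₀ a : Fin T → A) :
      1 / (T : ℝ) * ∑ t, (G.V (a₀ t) p₀ (y t) - G.V (a t) (ψ (π t)) (y t)) =
      1 / (T : ℝ) * ∑ t, (G.V (recs aStar ψ π t) (ψ (π t)) (y t) - G.V (a t) (ψ (π t)) (y t)) +
        (1 / (T : ℝ) * ∑ t, (G.V (a₀ t) p₀ (y t) -
          G.V (recs aStar (fun _ => p₀) π t) p₀ (y t)) +
        G.recRegret aStar ψ y π p₀) := by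
    simp only [Game.recRegret, recs, Finset.sum_sub_distrib]
    ring
  simp only [hsplit, expect_add _ (.all _) (memℓp_infty_const _), expect_const]
  rw [expect_add _ (memℓp_infty_const _) (.all _), expect_const,
    expect_add _ (.all _) (memℓp_infty_const _), expect_const]
  linarith [hR p₀ hp₀]

theorem Game.policyRegret_le_expect_add [Finite A] [Nonempty A] {ψ : stdSimplex ℝ Y → P}
    {F : Forecaster Y} {L : AgentAlg P A Y} {T : ℕ} {y : Fin T → Y}
    {ρ : (Fin T → stdSimplex ℝ Y) → ℝ} {εswap εneg M₁ M₂ : ℝ} (hρ : Memℓp ρ ∞) (hM : 0 ≤ M₁)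
    (hplay : ∀ π ∈ (forecastLaw F T y).support,
      G.NoContextualSwapRegret aStar ψ L y π εswap ∧
      G.Alignment aStar ψ L y π M₁ M₂ ∧
      G.NoNegativeCrossSwapRegret aStar ψ L y π εneg)
    (hrec : ∀ π, ∀ p₀ ∈ G.P₀, G.recRegret aStar ψ y π p₀ ≤ ρ π) :
    G.policyRegret aStar F ψ L y ≤
      expect (forecastLaw F T y) ρ + 2 * (M₁ * (εswap + εneg) + M₂) := by
  have hD := memℓp_infty_const (α := Fin T → stdSimplex ℝ Y) (2 * (M₁ * (εswap + εneg) + M₂))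
  refine (expect_mono _ (G.memℓp_infty_regretGiven aStar ψ L y) (hρ.add hD)
    fun π hπ => ?_).trans_eq ((expect_add _ hρ hD).trans (by rw [expect_const]))
  obtain ⟨hswap, halign, hneg⟩ := hplay π hπ
  exact G.regretGiven_le hM hswap halign hneg (hrec π)

theorem Game.mean_expV_sub_nonpos (hp : G.IsOptimalPolicy aStar pStar) {T : ℕ}
    (π : Fin T → stdSimplex ℝ Y) {p₀ : P} (hp₀ : p₀ ∈ G.P₀) :
    1 / (T : ℝ) * ∑ t, (G.expV (aStar p₀ (π t)) p₀ (π t) -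
      G.expV (aStar (pStar (π t)) (π t)) (pStar (π t)) (π t)) ≤ 0 :=
  mul_nonpos_of_nonneg_of_nonpos (by positivity)
    (Finset.sum_nonpos fun t _ => sub_nonpos.2 ((hp (π t)).2 p₀ hp₀))

variable [Fintype A]

theorem Game.abs_mean_expV_const_sub_le (aStar : P → stdSimplex ℝ Y → A) {T m : ℕ}
    {y : Fin T → Y} {π : Fin T → stdSimplex ℝ Y} {R : ℝ} (hR : 0 ≤ R)
    (hbias : ∀ i, condBias y π (G.eventsConst aStar i) ≤
      R * biasRate m π (G.eventsConst aStar i)) {p₀ : P} (hp₀ : p₀ ∈ G.P₀) :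
    |1 / (T : ℝ) * ∑ t, (G.expV (aStar p₀ (π t)) p₀ (π t) - G.V (aStar p₀ (π t)) p₀ (y t))| ≤
      R * totalRate Y m (G.P₀.card * Fintype.card A) T := by
  have hcard := totalRate_mono (Y := Y) m T
    (Nat.le_mul_of_pos_left (Fintype.card A) G.P₀_nonempty.card_pos)
  exact (abs_mean_sub_le_mul_totalRate (E := fun a => G.eventsConst aStar (⟨p₀, hp₀⟩, a))
    (c := aStar p₀) (w := fun a => G.V a p₀) (fun _ _ => Iff.rfl)
    (fun a k => abs_le.2 (G.V_mem a p₀ k)) hR fun a => hbias (⟨p₀, hp₀⟩, a)).trans (by gcongr)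

theorem Game.abs_mean_expV_mech_sub_le (hp : ∀ q, pStar q ∈ G.P₀) {T m : ℕ}
    {y : Fin T → Y} {π : Fin T → stdSimplex ℝ Y} {R : ℝ} (hR : 0 ≤ R)
    (hbias : ∀ i, condBias y π (G.eventsMech aStar pStar i) ≤
      R * biasRate m π (G.eventsMech aStar pStar i)) :
    |1 / (T : ℝ) * ∑ t, (G.expV (aStar (pStar (π t)) (π t)) (pStar (π t)) (π t) -
      G.V (aStar (pStar (π t)) (π t)) (pStar (π t)) (y t))| ≤
      R * totalRate Y m (G.P₀.card * Fintype.card A) T := by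
  have hlevel (q : stdSimplex ℝ Y) (i : G.P₀ × A) : q ∈ G.eventsMech aStar pStar i ↔
      ((⟨pStar q, hp q⟩ : G.P₀), aStar (pStar q) q) = i := by
    obtain ⟨⟨p, hpP⟩, a⟩ := i
    simp only [Game.eventsMech, Set.mem_ofPred_eq, Prod.mk.injEq, Subtype.mk.injEq]
    exact and_congr_right fun h => by rw [h]
  have hle := abs_mean_sub_le_mul_totalRate hlevel (w := fun i => G.V i.2 i.1)
    (fun i k => abs_le.2 (G.V_mem i.2 i.1 k)) hR hbias
  rwa [Fintype.card_prod, Fintype.card_coe] at hle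

theorem Game.recRegret_le (hp : G.IsOptimalPolicy aStar pStar) {T : ℕ}
    (hM : 1 < Fintype.card Y * Fintype.card ((G.P₀ × A) ⊕ (G.P₀ × A)) * T) (y : Fin T → Y)
    (π : Fin T → stdSimplex ℝ Y) {p₀ : P} (hp₀ : p₀ ∈ G.P₀) :
    G.recRegret aStar pStar y π p₀ ≤
      2 * (maxBiasRatio y (G.events aStar pStar) π * totalRate Y
        (Fintype.card ((G.P₀ × A) ⊕ (G.P₀ × A))) (G.P₀.card * Fintype.card A) T) := by
  have hR := maxBiasRatio_nonneg y (G.events aStar pStar) π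
  have hbias := condBias_le_maxBiasRatio_mul hM y (G.events aStar pStar) π
  have hconst := G.abs_mean_expV_const_sub_le aStar hR (fun i => hbias (Sum.inl i)) hp₀
  have hmech := G.abs_mean_expV_mech_sub_le (fun q => (hp q).1) hR fun i => hbias (Sum.inr i)
  have hopt := G.mean_expV_sub_nonpos hp π hp₀
  simp only [Game.recRegret, Finset.sum_sub_distrib, mul_sub] at hconst hmech hopt ⊢
  linarith [(abs_le.1 hconst).1, (abs_le.1 hmech).2]

theorem Game.logSize_card_events (T : ℕ) :
    logSize Y (Fintype.card ((G.P₀ × A) ⊕ (G.P₀ × A))) T =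
      Real.log (2 * Fintype.card Y * G.P₀.card * Fintype.card A * T) := by
  rw [logSize, G.card_events]
  push_cast
  ring_nf

variable [Nonempty A] [Nonempty Y]

theorem Game.one_lt_card_mul {T : ℕ} (hT : 0 < T) :
    1 < Fintype.card Y * Fintype.card ((G.P₀ × A) ⊕ (G.P₀ × A)) * T := by
  have hpos : 0 < Fintype.card Y * (G.P₀.card * Fintype.card A) * T :=
    Nat.mul_pos (Nat.mul_pos Fintype.card_pos
      (Nat.mul_pos G.P₀_nonempty.card_pos Fintype.card_pos)) hT
  rw [G.card_events]
  linarith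

theorem Game.policyRegret_le_min (hp : G.IsOptimalPolicy aStar pStar) {T : ℕ} (hT : 0 < T)
    {F : Forecaster Y} {K : ℝ} (hF : IsUnbiasedForecaster K F T (G.events aStar pStar))
    (L : AgentAlg P A Y) (y : Fin T → Y) {εswap εneg M₁ M₂ : ℝ} (hM₁ : 0 ≤ M₁)
    (hplay : ∀ π ∈ (forecastLaw F T y).support,
      G.NoContextualSwapRegret aStar pStar L y π εswap ∧
      G.Alignment aStar pStar L y π M₁ M₂ ∧
      G.NoNegativeCrossSwapRegret aStar pStar L y π εneg) :
    G.policyRegret aStar F pStar L y ≤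
      min 2 (2 * K * totalRate Y (Fintype.card ((G.P₀ × A) ⊕ (G.P₀ × A)))
        (G.P₀.card * Fintype.card A) T) + 2 * (M₁ * (εswap + εneg) + M₂) := by
  have hM := G.one_lt_card_mul hT
  set rate := totalRate Y (Fintype.card ((G.P₀ × A) ⊕ (G.P₀ × A))) (G.P₀.card * Fintype.card A) T
  have hratio : expect (forecastLaw F T y) (maxBiasRatio y (G.events aStar pStar)) ≤ K := hF y
  have htrivial := G.policyRegret_le_expect_add (memℓp_infty_const 2) hM₁ hplay
    fun π p₀ _ => G.recRegret_le_two pStar y π p₀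
  have hbias := G.policyRegret_le_expect_add
    ((memℓp_infty_maxBiasRatio hM y (G.events aStar pStar)).const_mul (2 * rate)) hM₁ hplay
    fun π p₀ hp₀ => (G.recRegret_le hp hM y π hp₀).trans_eq (by simp only [rate]; ring)
  rw [expect_const] at htrivial
  rw [expect_const_mul] at hbias
  rw [min_add]
  refine le_min htrivial (hbias.trans ?_)
  rw [mul_right_comm]
  gcongr
  exact totalRate_nonneg _ _ _

end Regret

end PrincipalAgent

theorem theorem5_general {P A Y : Type*} [Fintype A] [Nonempty A] [Fintype Y] [Nonempty Y]
    (G : Game P A Y) (aStar : P → stdSimplex ℝ Y → A) (pStar : stdSimplex ℝ Y → P)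
    (hp : G.IsOptimalPolicy aStar pStar) {T : ℕ} (hT : 0 < T) {K : ℝ} (hK : 10 ≤ K) :
    (∃ F : Forecaster Y, IsUnbiasedForecaster K F T (G.events aStar pStar)) ∧
    ∀ F : Forecaster Y, IsUnbiasedForecaster K F T (G.events aStar pStar) →
      ∀ (L : AgentAlg P A Y) (y : Fin T → Y) (εswap εneg M₁ M₂ : ℝ), 0 ≤ M₁ →
        (∀ π ∈ (forecastLaw F T y).support,
          G.NoContextualSwapRegret aStar pStar L y π εswap ∧
          G.Alignment aStar pStar L y π M₁ M₂ ∧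
          G.NoNegativeCrossSwapRegret aStar pStar L y π εneg) →
        G.policyRegret aStar F pStar L y ≤
          (4 * K + 2) * (Fintype.card Y * √(G.P₀.card * Fintype.card A / T) *
            √(Real.log (2 * Fintype.card Y * G.P₀.card * Fintype.card A * T))) +
          2 * (M₁ * (εswap + εneg) + M₂) := by
  constructor
  · obtain ⟨F, hF⟩ := exists_isUnbiasedForecaster (G.one_lt_card_mul hT) (G.events aStar pStar)
    exact ⟨F, fun y => (hF y).trans hK⟩
  · intro F hF L y εswap εneg M₁ M₂ hM₁ hplay
    rw [← G.logSize_card_events, ← Nat.cast_mul]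
    refine (G.policyRegret_le_min hp hT hF L y hM₁ hplay).trans ?_
    gcongr
    exact min_two_mul_totalRate_le (by linarith) _ _ _

theorem theorem5 :
    ∃ K₀ : ℝ, 0 < K₀ ∧ ∀ K : ℝ, K₀ ≤ K → ∃ C : ℝ, 0 < C ∧
      ∀ (P A Y : Type*) [Fintype A] [Nonempty A] [Fintype Y] [Nonempty Y]
        (G : Game P A Y) (aStar : P → stdSimplex ℝ Y → A) (pStar : stdSimplex ℝ Y → P),
        G.IsBestResponse aStar → G.IsOptimalPolicy aStar pStar →
        ∀ T : ℕ, 0 < T →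
          (∃ F : Forecaster Y, IsUnbiasedForecaster K F T (G.events aStar pStar)) ∧
          ∀ F : Forecaster Y, IsUnbiasedForecaster K F T (G.events aStar pStar) →
            ∀ (L : AgentAlg P A Y) (y : Fin T → Y) (εswap εneg M₁ M₂ : ℝ), 0 ≤ M₁ →
              (∀ π ∈ (forecastLaw F T y).support,
                G.NoContextualSwapRegret aStar pStar L y π εswap ∧
                G.Alignment aStar pStar L y π M₁ M₂ ∧
                G.NoNegativeCrossSwapRegret aStar pStar L y π εneg) →
              G.policyRegret aStar F pStar L y ≤
                C * (Fintype.card Y * √(G.P₀.card * Fintype.card A / T) *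
                  √(Real.log (2 * Fintype.card Y * G.P₀.card * Fintype.card A * T))) +
                2 * (M₁ * (εswap + εneg) + M₂) := by
  exact ⟨10, by norm_num, fun K hK => ⟨4 * K + 2, by linarith,
    fun _ _ _ _ _ _ _ G aStar pStar _ hp _ hT => theorem5_general G aStar pStar hp hT hK⟩⟩
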